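/- For a finite simple graph $G$ let $\rho(G)$ denote its spectral radius, i.e. the largest eigenvalue of its adjacency matrix, and let $\delta(G)$ denote its minimum degree. Write $K_m$ for the complete graph on $m$ vertices, $G_1+G_2$ for the disjoint union of two graphs, $2K_1=K_1+K_1$, and $G_1\vee G_2$ for the join, obtained from $G_1+G_2$ by adding all edges between $G_1$ and $G_2$. Let $G$ be a graph on $n\ge 7$ vertices with $\delta(G)\ge 1$, and let $G^{(1)}_n=K_1\vee(K_{n-3}+2K_1)$. If $\rho(G)\ge\rho(G^{(1)}_n)$, then $G$ contains a Hamilton path (a path through all its vertices) unless $G$ is isomorphic to $G^{(1)}_n$; and this is a genuine exception: $G^{(1)}_n$ contains no Hamilton path. -/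

import Mathlib

namespace SimpleGraph

/-- The join `G ∨ H` of two (disjoint) graphs: the disjoint union of `G` and `H` together with
all edges between the vertices of `G` and the vertices of `H`. -/
def graphJoin {V W : Type*} (G : SimpleGraph V) (H : SimpleGraph W) : SimpleGraph (V ⊕ W) :=
  (G ⊕g H) ⊔ completeBipartiteGraph V W

open Classical in
/-- The spectral radius `ρ(G)` of a finite graph: the largest eigenvalue of its real adjacency
matrix. (For a nonempty vertex set the set of eigenvalues is finite and nonempty, so that the
supremum is a maximum.) -/
noncomputable def spectralRadius {V : Type*} [Fintype V] (G : SimpleGraph V) : ℝ :=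
  sSup {μ : ℝ | Module.End.HasEigenvalue (Matrix.toLin' (G.adjMatrix ℝ)) μ}

/-- `G` contains a Hamilton path: a path through all its vertices. -/
def HasHamiltonPath {V : Type*} [DecidableEq V] (G : SimpleGraph V) : Prop :=
  ∃ (a b : V) (p : G.Walk a b), p.IsHamiltonian

/-- The graph `K₁ ∨ (K_{n-3} + 2K₁)`, which has `n` vertices when `3 ≤ n`. -/
def extremalGraph (n : ℕ) : SimpleGraph (Fin 1 ⊕ (Fin (n - 3) ⊕ (Fin 1 ⊕ Fin 1))) :=
  graphJoin (completeGraph (Fin 1))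
    (completeGraph (Fin (n - 3)) ⊕g (completeGraph (Fin 1) ⊕g completeGraph (Fin 1)))

end SimpleGraph

/-! The hypothesis on `ρ` is used only through `ρ > n - 3`: the extremal graph contains `K_{n-2}`
and its spectral radius is strictly larger than `n - 3` (`lt_spectralRadius_extremalGraph`). Hong's
bound `ρ² ≤ 2m - n + 1` (`sq_spectralRadius_le`) and parity then give `2m ≥ n² - 5n + 10`.

If there is no Hamilton path, a Chvátal-type argument in an edge-maximal supergraph without Hamilton
path (`exists_degree_obstruction`) yields `h` such that more than `h` vertices have degree at most
`h` and all but `h` vertices have degree at most `n - 2 - h`. Summing degrees and comparing with the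
lower bound leaves `0 ≤ (h - 1)(3h + 8 - 2n)`. For `h ≥ 2` only `(h, n) = (2, 7), (3, 8), (4, 10)`
survive, and there positive weight functions show `ρ ≤ n - 3`, a contradiction
(`eq_one_of_obstruction`). For `h = 1` the upper and lower bounds on the degree sum coincide, so
every degree is known and the graph is determined (`adj_iff_of_obstruction`).

Conversely, two pendant vertices at the same vertex must be the two ends of a Hamilton path, which
is impossible on four or more vertices. -/

namespace SimpleGraph

open Finset

/-! ### Bounds on the spectral radius -/

section Spectral

variable {V : Type*} [Fintype V]

/-- The eigenvalue equation of the adjacency matrix, written with neighbour sums. -/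
lemma hasEigenvalue_adjMatrix_iff (G : SimpleGraph V) [DecidableEq V] [DecidableRel G.Adj]
    (μ : ℝ) :
    Module.End.HasEigenvalue (Matrix.toLin' (G.adjMatrix ℝ)) μ ↔
      ∃ y : V → ℝ, y ≠ 0 ∧ ∀ i, ∑ j ∈ G.neighborFinset i, y j = μ * y i := by
  constructor
  · intro h
    obtain ⟨y, hy⟩ := h.exists_hasEigenvector
    refine ⟨y, hy.2, fun i => ?_⟩
    have h1 := congrFun hy.apply_eq_smul i
    rw [Matrix.toLin'_apply, adjMatrix_mulVec_apply] at h1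
    simpa using h1
  · rintro ⟨y, hy0, hy⟩
    refine Module.End.hasEigenvalue_of_hasEigenvector (x := y) ⟨?_, hy0⟩
    rw [Module.End.mem_eigenspace_iff]
    ext i
    rw [Matrix.toLin'_apply, adjMatrix_mulVec_apply, hy i]
    simp

/-- Trades the classical decidability instances of the definition for those in scope. -/
lemma spectralRadius_eq_sSup (G : SimpleGraph V) [DecidableEq V] [DecidableRel G.Adj] :
    G.spectralRadius =
      sSup {μ : ℝ | Module.End.HasEigenvalue (Matrix.toLin' (G.adjMatrix ℝ)) μ} := by
  unfold spectralRadius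
  congr!

/-- A positive spectral radius is attained by an eigenvector. -/
lemma exists_eigenvector_spectralRadius (G : SimpleGraph V) [DecidableRel G.Adj]
    (h : 0 < G.spectralRadius) :
    ∃ y : V → ℝ, y ≠ 0 ∧ ∀ i, ∑ j ∈ G.neighborFinset i, y j = G.spectralRadius * y i := by
  classical
  rw [← hasEigenvalue_adjMatrix_iff]
  rw [spectralRadius_eq_sSup] at h ⊢
  refine Set.Nonempty.csSup_mem ?_ (Module.End.finite_hasEigenvalue _)
  by_contra hne
  -- The supremum of the empty set is `0` by convention, so positivity already provides an
  -- eigenvalue.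
  rw [Set.not_nonempty_iff_eq_empty.mp hne, Real.sSup_empty] at h
  exact lt_irrefl _ h

lemma le_spectralRadius (G : SimpleGraph V) [DecidableRel G.Adj] {μ : ℝ} {y : V → ℝ}
    (hy0 : y ≠ 0) (hy : ∀ i, ∑ j ∈ G.neighborFinset i, y j = μ * y i) :
    μ ≤ G.spectralRadius := by
  classical
  rw [spectralRadius_eq_sSup]
  exact le_csSup (Module.End.finite_hasEigenvalue _).bddAbove
    ((hasEigenvalue_adjMatrix_iff G μ).2 ⟨y, hy0, hy⟩)

/-- A positive weight function whose neighbour sums are at most `r` times the weights bounds the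
spectral radius by `r`. -/
lemma spectralRadius_le_of_weight (G : SimpleGraph V) [DecidableRel G.Adj] {r : ℝ} (hr : 0 ≤ r)
    (w : V → ℝ) (hw : ∀ i, 0 < w i) (h : ∀ i, ∑ j ∈ G.neighborFinset i, w j ≤ r * w i) :
    G.spectralRadius ≤ r := by
  by_contra! hlt
  obtain ⟨y, hy0, hy⟩ := G.exists_eigenvector_spectralRadius (hr.trans_lt hlt)
  obtain ⟨k, hk⟩ := Function.ne_iff.mp hy0
  -- Compare `|y|` with the smallest multiple `t * w` above it; they touch at `i`, where the
  -- eigenvalue equation gives the contradiction.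
  obtain ⟨i, -, hi⟩ := Finset.exists_max_image univ (fun i => |y i| / w i) ⟨k, mem_univ k⟩
  set t := |y i| / w i with ht
  have hle : ∀ j, |y j| ≤ t * w j := fun j => by
    have := hi j (mem_univ j)
    rwa [div_le_iff₀ (hw j)] at this
  have htpos : 0 < t := lt_of_lt_of_le (div_pos (abs_pos.mpr hk) (hw k)) (hi k (mem_univ k))
  have hyi : |y i| = t * w i := by rw [ht, div_mul_cancel₀ _ (hw i).ne']
  have h1 : G.spectralRadius * (t * w i) ≤ r * (t * w i) := by
    calc G.spectralRadius * (t * w i) = |∑ j ∈ G.neighborFinset i, y j| := by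
          rw [hy i, abs_mul, hyi, abs_of_nonneg (hr.trans hlt.le)]
      _ ≤ ∑ j ∈ G.neighborFinset i, |y j| := abs_sum_le_sum_abs _ _
      _ ≤ ∑ j ∈ G.neighborFinset i, t * w j := sum_le_sum fun j _ => hle j
      _ = t * ∑ j ∈ G.neighborFinset i, w j := by rw [mul_sum]
      _ ≤ t * (r * w i) := mul_le_mul_of_nonneg_left (h i) htpos.le
      _ = r * (t * w i) := by ring
  exact absurd (le_of_mul_le_mul_right h1 (mul_pos htpos (hw i))) (not_le.mpr hlt)

/-- Hong's bound: `ρ² ≤ 2m - n + 1` for a graph without isolated vertices. -/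
lemma sq_spectralRadius_le (G : SimpleGraph V) [DecidableEq V] [DecidableRel G.Adj]
    (hd : ∀ v, 1 ≤ G.degree v) (hpos : 0 < G.spectralRadius) :
    G.spectralRadius ^ 2 ≤ ((∑ v, G.degree v : ℕ) : ℝ) - Fintype.card V + 1 := by
  obtain ⟨y, hy0, hy⟩ := G.exists_eigenvector_spectralRadius hpos
  set ρ := G.spectralRadius
  set S := ∑ j, y j ^ 2 with hS
  have hSpos : 0 < S := by
    obtain ⟨k, hk⟩ := Function.ne_iff.mp hy0
    exact sum_pos' (fun j _ => sq_nonneg _) ⟨k, mem_univ k, sq_pos_of_ne_zero hk⟩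
  -- Cauchy–Schwarz applied to the eigenvalue equation at `i`.
  have hrow : ∀ i, ρ ^ 2 * y i ^ 2 ≤
      ∑ j, (if G.Adj i j then (G.degree i : ℝ) * y j ^ 2 else 0) := fun i => by
    have h1 := sq_sum_le_card_mul_sum_sq (s := G.neighborFinset i) (f := y)
    rw [hy i, card_neighborFinset_eq_degree, mul_pow, mul_sum] at h1
    rwa [← sum_filter, ← neighborFinset_eq_filter]
  -- The degrees of the neighbours of `j` sum to `2m` minus `deg j` minus the degrees of the `n - 1
  -- - deg j` other non-neighbours, each at least `1`; `deg j` cancels.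
  have hcol : ∀ j, ∑ i, (if G.Adj i j then (G.degree i : ℝ) else 0) ≤
      ((∑ v, G.degree v : ℕ) : ℝ) - Fintype.card V + 1 := fun j => by
    have h2 : ∀ i, (if G.Adj i j then (G.degree i : ℝ) else 0) ≤
        ((G.degree i : ℝ) - 1) + ((if G.Adj j i then 1 else 0) +
          if i = j then 1 - (G.degree i : ℝ) else 0) := fun i => by
      have := hd i
      have h3 : (1 : ℝ) ≤ G.degree i := by exact_mod_cast this
      simp only [G.adj_comm j i]
      by_cases hij : i = j
      · subst hij; simp
      · by_cases ha : G.Adj i j <;> simp [ha, hij, h3]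
    refine (sum_le_sum fun i _ => h2 i).trans (le_of_eq ?_)
    rw [sum_add_distrib, sum_add_distrib, sum_sub_distrib, sum_ite_eq' univ j, ← sum_filter,
      ← neighborFinset_eq_filter]
    simp
  have htot : ρ ^ 2 * S ≤ (((∑ v, G.degree v : ℕ) : ℝ) - Fintype.card V + 1) * S := by
    calc ρ ^ 2 * S = ∑ i, ρ ^ 2 * y i ^ 2 := by rw [hS, mul_sum]
      _ ≤ ∑ i, ∑ j, (if G.Adj i j then (G.degree i : ℝ) * y j ^ 2 else 0) :=
          sum_le_sum fun i _ => hrow i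
      _ = ∑ j, (∑ i, if G.Adj i j then (G.degree i : ℝ) else 0) * y j ^ 2 := by
          rw [sum_comm]
          refine sum_congr rfl fun j _ => ?_
          rw [sum_mul]
          exact sum_congr rfl fun i _ => by split_ifs <;> simp
      _ ≤ ∑ j, (((∑ v, G.degree v : ℕ) : ℝ) - Fintype.card V + 1) * y j ^ 2 :=
          sum_le_sum fun j _ => mul_le_mul_of_nonneg_right (hcol j) (sq_nonneg _)
      _ = _ := by rw [hS, mul_sum]
  exact le_of_mul_le_mul_right htot hSpos

end Spectral

/-! ### Hamilton paths as lists, and Ore's rerouting argument -/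

section Traceable

variable {V : Type*}

/-- A Hamilton path is a chain listing all vertices without repetition. -/
lemma hasHamiltonPath_iff_exists_list [DecidableEq V] [Nonempty V] (G : SimpleGraph V) :
    G.HasHamiltonPath ↔ ∃ l : List V, l.Nodup ∧ (∀ x, x ∈ l) ∧ l.IsChain G.Adj := by
  constructor
  · rintro ⟨a, b, p, hp⟩
    exact ⟨p.support, hp.isPath.support_nodup, hp.mem_support, p.isChain_adj_support⟩
  · rintro ⟨l, hl, hmem, hc⟩
    have hne : l ≠ [] := by
      rintro rfl
      simpa using hmem (Classical.arbitrary V)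
    refine ⟨_, _, Walk.ofSupport l hne hc, ?_⟩
    refine Walk.IsPath.isHamiltonian_of_mem (Walk.IsPath.mk' ?_) ?_
    · rwa [Walk.support_ofSupport]
    · simpa [Walk.support_ofSupport] using hmem

lemma isChain_adj_reverse {G : SimpleGraph V} {l : List V} (h : l.IsChain G.Adj) :
    l.reverse.IsChain G.Adj := by
  rw [List.isChain_reverse]
  exact h.imp fun _ _ h => h.symm

/-- A spanning path with one adjacency missing can be rerouted if the missing edge is bypassed by
reversing the end segment `P₂`. -/
lemma isChain_reroute_left {G : SimpleGraph V} {P₁ P₂ Q : List V}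
    (hP : (P₁ ++ P₂).IsChain G.Adj) (hQ : Q.IsChain G.Adj)
    (h₁ : ∀ x ∈ P₁.getLast?, ∀ y ∈ P₂.getLast?, G.Adj x y)
    (h₂ : ∀ x ∈ P₂.head?, ∀ y ∈ Q.head?, G.Adj x y) (hne : P₂ ≠ []) :
    (P₁ ++ (P₂.reverse ++ Q)).IsChain G.Adj := by
  rw [List.isChain_append] at hP
  rw [List.isChain_append, List.isChain_append]
  refine ⟨hP.1, ⟨isChain_adj_reverse hP.2.1, hQ, by simpa using h₂⟩, ?_⟩
  have : (P₂.reverse ++ Q).head? = P₂.getLast? := by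
    rw [List.head?_append_of_ne_nil _ (by simpa using hne), List.head?_reverse]
  rw [this]
  exact h₁

/-- The mirror image of `isChain_reroute_left`: the initial segment `Q₁` is reversed. -/
lemma isChain_reroute_right {G : SimpleGraph V} {P Q₁ Q₂ : List V}
    (hP : P.IsChain G.Adj) (hQ : (Q₁ ++ Q₂).IsChain G.Adj)
    (h₁ : ∀ x ∈ P.getLast?, ∀ y ∈ Q₁.getLast?, G.Adj x y)
    (h₂ : ∀ x ∈ Q₁.head?, ∀ y ∈ Q₂.head?, G.Adj x y) (hne : Q₁ ≠ []) :
    ((P ++ Q₁.reverse) ++ Q₂).IsChain G.Adj := by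
  rw [List.isChain_append] at hQ
  rw [List.isChain_append, List.isChain_append]
  refine ⟨⟨hP, isChain_adj_reverse hQ.1, by simpa using h₁⟩, hQ.2.1, ?_⟩
  have : (P ++ Q₁.reverse).getLast? = Q₁.head? := by
    rw [List.getLast?_append_of_ne_nil _ (by simpa using hne), List.getLast?_reverse]
  rw [this]
  exact h₂

/-- The number of positions of neighbours in a list of all vertices is the degree. -/
lemma card_filter_getElem_adj [Fintype V] {G : SimpleGraph V} [DecidableRel G.Adj] {l : List V}
    (hl : l.Nodup) (hmem : ∀ x, x ∈ l) (u : V) :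
    #{i ∈ range l.length | G.Adj u (l.getD i u)} = G.degree u := by
  rw [← card_neighborFinset_eq_degree]
  refine card_bij (fun i _ => l.getD i u) ?_ ?_ ?_
  · intro i hi
    simpa using (mem_filter.mp hi).2
  · intro i hi j hj hij
    have hi' := mem_range.mp (mem_filter.mp hi).1
    have hj' := mem_range.mp (mem_filter.mp hj).1
    simp only [List.getD_eq_getElem _ _ hi', List.getD_eq_getElem _ _ hj'] at hij
    exact (hl.getElem_inj_iff).mp hij
  · intro x hx
    obtain ⟨i, hi, rfl⟩ := List.getElem_of_mem (hmem x)
    refine ⟨i, ?_, List.getD_eq_getElem _ _ hi⟩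
    rw [mem_filter, List.getD_eq_getElem _ _ hi]
    exact ⟨mem_range.mpr hi, by simpa using hx⟩

/-- Ore's argument for a spanning path broken between `u` and `v`. If `u` is adjacent to `l[i]` and
`v` to `l[i + 1]`, reversing the segment between the break and this pair repairs the path. So the
neighbour positions of `u`, shifted by one, avoid those of `v`. -/
lemma degree_add_degree_le_of_chains [Fintype V] [DecidableEq V] {G : SimpleGraph V}
    [DecidableRel G.Adj] (hG : ¬ G.HasHamiltonPath) {u v : V} {P Q : List V}
    (hnd : (P ++ u :: v :: Q).Nodup) (hmem : ∀ x, x ∈ P ++ u :: v :: Q)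
    (hP : (P ++ [u]).IsChain G.Adj) (hQ : (v :: Q).IsChain G.Adj) :
    G.degree u + G.degree v + 2 ≤ Fintype.card V := by
  have : Nonempty V := ⟨u⟩
  rw [hasHamiltonPath_iff_exists_list] at hG
  set l := P ++ u :: v :: Q with hl
  have hperm : ∀ l' : List V, l'.Perm l → ¬ l'.IsChain G.Adj := fun l' hp hc =>
    hG ⟨l', hp.nodup_iff.mpr hnd, fun x => hp.mem_iff.mpr (hmem x), hc⟩
  have hcard : l.length = Fintype.card V := by
    rw [← List.toFinset_card_of_nodup hnd, ← card_univ]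
    congr 1
    ext x
    simpa using hmem x
  have hleft : ∀ P₁ P₂, P ++ [u] = P₁ ++ P₂ → P₂ ≠ [] → (∀ x ∈ P₁.getLast?, G.Adj u x) →
      (∀ x ∈ P₂.head?, G.Adj v x) → False := by
    intro P₁ P₂ he hne h₁ h₂
    have hlast : P₂.getLast? = some u := by
      rw [← List.getLast?_append_of_ne_nil P₁ hne, ← he]
      simp
    refine hperm (P₁ ++ (P₂.reverse ++ v :: Q)) ?_
      (isChain_reroute_left (he ▸ hP) hQ ?_ ?_ hne)
    · have : l = P₁ ++ (P₂ ++ v :: Q) := by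
        rw [← List.append_assoc, ← he, hl]
        simp
      rw [this]
      exact List.Perm.append_left _ (List.Perm.append_right _ (List.reverse_perm _))
    · rw [hlast]
      intro x hx y hy
      simp only [Option.mem_some_iff] at hy
      exact hy ▸ (h₁ x hx).symm
    · intro x hx y hy
      simp only [List.head?_cons, Option.mem_some_iff] at hy
      exact hy ▸ (h₂ x hx).symm
  have hright : ∀ Q₁ Q₂, v :: Q = Q₁ ++ Q₂ → Q₁ ≠ [] → (∀ x ∈ Q₁.getLast?, G.Adj u x) →
      (∀ x ∈ Q₂.head?, G.Adj v x) → False := by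
    intro Q₁ Q₂ he hne h₁ h₂
    have hhead : Q₁.head? = some v := by
      rw [← List.head?_append_of_ne_nil Q₁ hne (l₂ := Q₂), ← he]
      simp
    refine hperm (((P ++ [u]) ++ Q₁.reverse) ++ Q₂) ?_
      (isChain_reroute_right hP (he ▸ hQ) ?_ ?_ hne)
    · have : l = ((P ++ [u]) ++ Q₁) ++ Q₂ := by
        rw [List.append_assoc _ Q₁, ← he, hl]
        simp
      rw [this]
      exact List.Perm.append_right _ (List.Perm.append_left _ (List.reverse_perm _))
    · intro x hx y hy
      simp only [List.getLast?_append, List.getLast?_singleton, Option.some_or,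
        Option.mem_some_iff] at hx
      exact hx ▸ h₁ y hy
    · rw [hhead]
      intro x hx y hy
      simp only [Option.mem_some_iff] at hx
      exact hx ▸ h₂ y hy
  have hcross : ∀ i, (hi : i + 1 < l.length) → G.Adj u l[i] → G.Adj v l[i + 1] → False := by
    intro i hi h₁ h₂
    rcases lt_trichotomy i P.length with h | h | h
    · have e₁ : ((P ++ [u]).take (i + 1)).getLast? = some l[i] := by
        clear * - h
        rw [List.getLast?_take]
        grind
      have e₂ : ((P ++ [u]).drop (i + 1)).head? = some l[i + 1] := by
        clear * - h
        rw [List.head?_drop]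
        grind
      refine hleft _ _ (List.take_append_drop (i + 1) _).symm ?_ ?_ ?_
      · rw [← List.length_pos_iff]
        simpa using h
      · rw [e₁]
        rintro x ⟨⟩
        exact h₁
      · rw [e₂]
        rintro x ⟨⟩
        exact h₂
    · subst h
      simp [hl] at h₁
    · have e₁ : ((v :: Q).take (i - P.length)).getLast? = some l[i] := by
        clear * - h hi
        rw [List.getLast?_take]
        grind
      have e₂ : ((v :: Q).drop (i - P.length)).head? = some l[i + 1] := by
        clear * - h hi
        rw [List.head?_drop]
        grind
      refine hright _ _ (List.take_append_drop (i - P.length) _).symm ?_ ?_ ?_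
      · intro h0
        simp [h0] at e₁
      · rw [e₁]
        rintro x ⟨⟩
        exact h₁
      · rw [e₂]
        rintro x ⟨⟩
        exact h₂
  have hfirst : (h : 0 < l.length) → ¬ G.Adj v l[0] := by
    intro h h₂
    have e : (P ++ [u]).head? = some l[0] := by
      clear * -
      cases P <;> simp [l]
    refine hleft [] (P ++ [u]) (by simp) (by simp) (by simp) ?_
    rw [e]
    rintro x ⟨⟩
    exact h₂
  have hlast : (h : l.length - 1 < l.length) → ¬ G.Adj u l[l.length - 1] := by
    intro h h₂
    have e : (v :: Q).getLast? = some l[l.length - 1] := by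
      clear * -
      rw [List.getLast?_eq_getElem?]
      grind
    refine hright (v :: Q) [] (by simp) (by simp) ?_ (by simp)
    rw [e]
    rintro x ⟨⟩
    exact h₂
  rw [← card_filter_getElem_adj hnd hmem u, ← card_filter_getElem_adj hnd hmem v, ← hcard]
  set S := {i ∈ range l.length | G.Adj u (l.getD i u)} with hS
  set T := {i ∈ range l.length | G.Adj v (l.getD i v)} with hT
  have hlen : P.length + 1 < l.length := by simp [hl]
  have hdisj : Disjoint (S.image (· + 1)) T := by
    rw [Finset.disjoint_left]
    intro j hj hj'
    obtain ⟨i, hi, rfl⟩ := mem_image.mp hj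
    simp only [hS, hT, mem_filter, mem_range] at hi hj'
    rw [List.getD_eq_getElem _ _ hi.1] at hi
    rw [List.getD_eq_getElem _ _ hj'.1] at hj'
    exact hcross i hj'.1 hi.2 hj'.2
  -- Of the `n` positions two are lost: `0`, since `v` misses the first vertex, and that of `v`
  -- itself, since neither `u` nor `v` is its own neighbour. The shift stays in range because `u`
  -- misses the last vertex.
  have hsub : S.image (· + 1) ∪ T ⊆ ((range l.length).erase 0).erase (P.length + 1) := by
    intro j hj
    rcases mem_union.mp hj with hj | hj
    · obtain ⟨i, hi, rfl⟩ := mem_image.mp hj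
      simp only [hS, mem_filter, mem_range] at hi
      rw [List.getD_eq_getElem _ _ hi.1] at hi
      have h1 : i ≠ l.length - 1 := by
        rintro rfl
        exact hlast hi.1 hi.2
      have h2 : i ≠ P.length := by
        rintro rfl
        simp [hl] at hi
      simp only [mem_erase, mem_range]
      omega
    · simp only [hT, mem_filter, mem_range] at hj
      rw [List.getD_eq_getElem _ _ hj.1] at hj
      have h1 : j ≠ 0 := by
        rintro rfl
        exact hfirst hj.1 hj.2
      have h2 : j ≠ P.length + 1 := by
        rintro rfl
        simp [hl] at hj
      simp only [mem_erase, mem_range]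
      omega
  have hle := card_le_card hsub
  rw [card_union_of_disjoint hdisj, card_image_of_injective _ (add_left_injective 1),
    card_erase_of_mem (by simp only [mem_erase, mem_range]; omega),
    card_erase_of_mem (by simp only [mem_range]; omega), card_range] at hle
  omega

/-- In an edge-maximal graph without Hamilton path, nonadjacent vertices have degree sum at most
`n - 2`. -/
lemma degree_add_degree_le_of_maximal [Fintype V] [DecidableEq V] {G : SimpleGraph V}
    [DecidableRel G.Adj] (hG : Maximal (fun H : SimpleGraph V => ¬ H.HasHamiltonPath) G) {u v : V}
    (hne : u ≠ v) (huv : ¬ G.Adj u v) :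
    G.degree u + G.degree v + 2 ≤ Fintype.card V := by
  have : Nonempty V := ⟨u⟩
  have hham : (G ⊔ edge u v).HasHamiltonPath := by
    by_contra h
    have := hG.2 h le_sup_left
    exact huv (this (Or.inr (by simp [edge_adj, hne])))
  obtain ⟨l, hnd, hmem, hc⟩ := (hasHamiltonPath_iff_exists_list _).mp hham
  have hnot : ¬ l.IsChain G.Adj := fun h =>
    hG.1 ((hasHamiltonPath_iff_exists_list _).mpr ⟨l, hnd, hmem, h⟩)
  rw [List.isChain_iff_getElem] at hnot
  push Not at hnot
  obtain ⟨i, hi, hna⟩ := hnot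
  have hi' : i < l.length := by omega
  set a := l[i] with ha
  set b := l[i + 1] with hb
  have hsplit : l = l.take i ++ a :: b :: l.drop (i + 2) := by
    rw [ha, hb, List.getElem_cons_drop, List.getElem_cons_drop, List.take_append_drop]
  have hab : (u = a ∧ v = b) ∨ (u = b ∧ v = a) := by
    have := (List.isChain_iff_getElem.mp hc) i hi
    rw [sup_adj, edge_adj] at this
    rcases this with h | h
    · exact absurd h hna
    · grind
  rw [hsplit] at hnd hmem hc
  -- The list has no repetition, so neither side of the break contains both `a` and `b`, and the new
  -- edge is used nowhere else.
  have hrestrict : ∀ l' : List V, l'.IsChain (G ⊔ edge u v).Adj → (a ∉ l' ∨ b ∉ l') →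
      l'.IsChain G.Adj := by
    intro l' h hnm
    rw [List.isChain_iff_getElem] at h ⊢
    intro j hj
    rcases h j hj with h | h
    · exact h
    · rw [edge_adj] at h
      have h1 : l'[j] ∈ l' := List.getElem_mem _
      have h2 : l'[j + 1] ∈ l' := List.getElem_mem _
      grind
  rw [List.isChain_append_cons_cons] at hc
  have hP := hrestrict _ hc.1 (by right; grind)
  have hQ := hrestrict _ hc.2.2 (by left; grind)
  have key := degree_add_degree_le_of_chains hG.1 hnd hmem hP hQ
  rcases hab with ⟨rfl, rfl⟩ | ⟨rfl, rfl⟩ <;> omega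

end Traceable

/-! ### Degree patterns of graphs without Hamilton path -/

section Degrees

variable {V : Type*} [Fintype V]

lemma exists_nonadj_of_not_hasHamiltonPath [DecidableEq V] [Nonempty V] {G : SimpleGraph V}
    (hG : ¬ G.HasHamiltonPath) : ∃ u v, u ≠ v ∧ ¬ G.Adj u v := by
  by_contra! h
  refine hG ((hasHamiltonPath_iff_exists_list G).mpr
    ⟨univ.toList, nodup_toList _, by simp, ?_⟩)
  exact (List.Pairwise.imp (fun hab => h _ _ hab) (nodup_toList univ)).isChain

/-- Chvátal's degree condition: in a graph without Hamilton path and without isolated vertices there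
are, for some `1 ≤ h ≤ n / 2 - 1`, more than `h` vertices of degree at most `h`, while all but `h`
vertices have degree at most `n - 2 - h`. -/
lemma exists_degree_obstruction [DecidableEq V] [Nonempty V] {G : SimpleGraph V}
    [DecidableRel G.Adj] (hG : ¬ G.HasHamiltonPath) (hd : ∀ v, 1 ≤ G.degree v) :
    ∃ (h : ℕ) (A C : Finset V), 1 ≤ h ∧ 2 * h + 2 ≤ Fintype.card V ∧ h + 1 ≤ #A ∧ #C = h ∧
      (∀ x ∈ A, G.degree x ≤ h) ∧ ∀ x, x ∉ C → G.degree x + h + 2 ≤ Fintype.card V := by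
  classical
  obtain ⟨H, hGH, hH⟩ := Finite.exists_le_maximal
    (p := fun H : SimpleGraph V => ¬ H.HasHamiltonPath) hG
  have hdeg : ∀ x, G.degree x ≤ H.degree x := fun x => degree_le_of_le hGH
  obtain ⟨u₀, v₀, hne₀, hna₀⟩ := exists_nonadj_of_not_hasHamiltonPath hH.1
  obtain ⟨⟨u, v⟩, huv, hmax⟩ := exists_max_image
    ({p : V × V | p.1 ≠ p.2 ∧ ¬ H.Adj p.1 p.2} : Finset (V × V))
    (fun p => H.degree p.1 + H.degree p.2) ⟨(u₀, v₀), by simp [hne₀, hna₀]⟩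
  simp only [mem_filter, mem_univ, true_and, Prod.forall, ne_eq] at huv hmax
  wlog hle : H.degree u ≤ H.degree v generalizing u v
  · refine this v u ⟨fun h => huv.1 h.symm, fun h => huv.2 h.symm⟩ (fun a b hab => ?_) (by omega)
    have := hmax a b hab
    omega
  have hore := degree_add_degree_le_of_maximal hH huv.1 huv.2
  -- Among nonadjacent pairs `u, v` has maximal degree sum, so every non-neighbour of `v` has degree
  -- at most that of `u`; Ore's inequality makes these numerous. Vertices outside `H.neighborFinset
  -- u` are bounded by Ore's inequality with `u`.
  refine ⟨H.degree u, univ \ insert v (H.neighborFinset v), H.neighborFinset u,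
    (hd u).trans (hdeg u), by omega, ?_, card_neighborFinset_eq_degree _ _, ?_, ?_⟩
  · rw [card_sdiff_of_subset (subset_univ _), card_univ, card_insert_of_notMem (by simp),
      card_neighborFinset_eq_degree]
    omega
  · intro x hx
    simp only [mem_sdiff, mem_univ, mem_insert, mem_neighborFinset, not_or, true_and] at hx
    have := hmax x v ⟨hx.1, fun h => hx.2 h.symm⟩
    have := hdeg x
    omega
  · intro x hx
    rw [mem_neighborFinset] at hx
    have := hdeg x
    by_cases hxu : u = x
    · subst hxu
      omega
    · have := degree_add_degree_le_of_maximal hH hxu hx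
      omega

/-- The pointwise degree bound implied by `exists_degree_obstruction`. -/
lemma degree_le_of_obstruction [DecidableEq V] {G : SimpleGraph V} [DecidableRel G.Adj] {h : ℕ}
    {A C : Finset V} (hA : ∀ x ∈ A, G.degree x ≤ h)
    (hC : ∀ x, x ∉ C → G.degree x + h + 2 ≤ Fintype.card V) (x : V) :
    (G.degree x : ℤ) ≤ (Fintype.card V - 2 - h) - (if x ∈ A then (Fintype.card V : ℤ) - 2 - 2 * h
      else 0) + (if x ∈ C then (h : ℤ) + 1 else 0) := by
  have h1 := hA x
  have h2 := hC x
  have h3 := G.degree_lt_card_verts x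
  -- On `A ∩ C` the bound is `2h + 1`, more than the true `h`; this slack later excludes `c ∈ A`.
  split_ifs with h4 h5 h5
  · have := h1 h4; omega
  · have := h1 h4; omega
  · omega
  · have := h2 h5; omega

lemma sum_obstruction [DecidableEq V] (h : ℕ) (A C : Finset V) :
    ∑ x : V, (((Fintype.card V : ℤ) - 2 - h) -
      (if x ∈ A then (Fintype.card V : ℤ) - 2 - 2 * h else 0) +
      (if x ∈ C then (h : ℤ) + 1 else 0)) =
    Fintype.card V * ((Fintype.card V : ℤ) - 2 - h) - #A * ((Fintype.card V : ℤ) - 2 - 2 * h) +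
      #C * ((h : ℤ) + 1) := by
  rw [sum_add_distrib, sum_sub_distrib, sum_ite_mem, sum_ite_mem, univ_inter, univ_inter]
  simp
  ring

/-- A neighbour sum of a positive weight is at most the total weight of the other vertices. -/
lemma sum_neighborFinset_add_le [DecidableEq V] (G : SimpleGraph V) [DecidableRel G.Adj]
    {w : V → ℝ} (hw : ∀ i, 0 ≤ w i) (x : V) :
    ∑ j ∈ G.neighborFinset x, w j + w x ≤ ∑ j, w j := by
  rw [add_comm, ← sum_insert (f := w) (by simp : x ∉ G.neighborFinset x)]
  exact sum_le_sum_of_subset_of_nonneg (subset_univ _) fun i _ _ => hw i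

lemma sum_neighborFinset_le [DecidableEq V] (G : SimpleGraph V) [DecidableRel G.Adj]
    {w : V → ℝ} {x : V} {d : ℕ} {b : ℝ} (hb : 0 ≤ b) (hd : G.degree x ≤ d)
    (hw : ∀ i, w i ≤ b) : ∑ j ∈ G.neighborFinset x, w j ≤ d * b := by
  refine (sum_le_card_nsmul _ _ b fun i _ => hw i).trans ?_
  rw [card_neighborFinset_eq_degree, nsmul_eq_mul]
  exact mul_le_mul_of_nonneg_right (by exact_mod_cast hd) hb

/-- If all vertices outside a set of `h` vertices have degree at most `h`, then `ρ ≤ r` as soon as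
`h r + (n - h) h ≤ r (r + 1)`. -/
lemma spectralRadius_le_of_degree_le [DecidableEq V] (G : SimpleGraph V) [DecidableRel G.Adj]
    {h : ℕ} {r : ℝ} {C : Finset V} (h0 : 0 < h) (hr : h ≤ r) (hC : #C = h)
    (hd : ∀ x, x ∉ C → G.degree x ≤ h)
    (hle : h * r + (Fintype.card V - h) * h ≤ r * (r + 1)) : G.spectralRadius ≤ r := by
  have h0' : (0 : ℝ) < h := by exact_mod_cast h0
  have hr0 : 0 < r := h0'.trans_le hr
  -- Off `C`, at most `h` neighbours of weight at most `r` give `h * r`, as needed. On `C`, the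
  -- total weight minus `r` must be at most `r²`, which is `hle`.
  set w : V → ℝ := fun x => if x ∈ C then r else h with hw
  have hwpos : ∀ x, 0 < w x := fun x => by simp only [hw]; split_ifs <;> assumption
  refine G.spectralRadius_le_of_weight hr0.le w hwpos fun x => ?_
  by_cases hx : x ∈ C
  · have h1 := G.sum_neighborFinset_add_le (fun i => (hwpos i).le) x
    have h2 : ∑ j, w j = h * r + (Fintype.card V - h) * h := by
      have : ∀ j, w j = h + if j ∈ C then r - h else 0 := fun j => by
        simp only [hw]; split_ifs <;> ring
      simp only [this]
      rw [sum_add_distrib, sum_ite_mem, univ_inter]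
      simp [hC]
      ring
    have h3 : w x = r := by simp [hw, hx]
    rw [h3] at h1 ⊢
    linarith
  · have h3 : w x = h := by simp [hw, hx]
    rw [h3, mul_comm]
    exact G.sum_neighborFinset_le hr0.le (hd x hx) fun i => by
      simp only [hw]; split_ifs <;> simp [hr]

/-- The exceptional degree pattern on seven vertices has spectral radius at most `4`. -/
lemma spectralRadius_le_four [DecidableEq V] (G : SimpleGraph V) [DecidableRel G.Adj]
    (hV : Fintype.card V = 7) {A C : Finset V} (hA : 3 ≤ #A) (hC : #C = 2)
    (hdA : ∀ x ∈ A, G.degree x ≤ 2) (hdC : ∀ x, x ∉ C → G.degree x ≤ 3) :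
    G.spectralRadius ≤ 4 := by
  -- Chosen so that the estimates are tight: `2 * 12 = 4 * 6` on `A`, `2 * 12 + 8 = 4 * 8` off `A ∪
  -- C`, and `60 - 12 = 4 * 12` on `C \ A`.
  set w : V → ℝ := fun x => if x ∈ C then 12 else if x ∈ A then 6 else 8 with hw
  have hwpos : ∀ x, 0 < w x := fun x => by simp only [hw]; split_ifs <;> norm_num
  refine G.spectralRadius_le_of_weight (by norm_num) w hwpos fun x => ?_
  by_cases hxA : x ∈ A
  · have h1 := G.sum_neighborFinset_le (w := w) (b := 12) (by norm_num) (hdA x hxA) fun i => by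
      simp only [hw]; split_ifs <;> norm_num
    have h2 : 6 ≤ w x := by simp only [hw]; split_ifs <;> norm_num
    push_cast at h1
    linarith
  by_cases hxC : x ∈ C
  · have h1 := G.sum_neighborFinset_add_le (fun i => (hwpos i).le) x
    have h2 : ∑ j, w j = 64 - 2 * #(A \ C) := by
      have : ∀ j, w j = 8 + (if j ∈ C then 4 else 0) - if j ∈ A \ C then 2 else 0 := fun j => by
        simp only [hw, mem_sdiff]
        by_cases hc : j ∈ C <;> by_cases ha : j ∈ A <;> simp [hc, ha] <;> norm_num
      simp only [this]
      rw [sum_sub_distrib, sum_add_distrib, sum_ite_mem, sum_ite_mem, univ_inter, univ_inter]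
      simp [hC, hV]
      ring
    have h3 : w x = 12 := by simp [hw, hxC]
    have h4 : 2 ≤ #(A \ C) := by
      have h5 : #(A ∩ C) ≤ #(C.erase x) := card_le_card fun y hy => by
        rw [mem_inter] at hy
        exact mem_erase.mpr ⟨fun h => hxA (h ▸ hy.1), hy.2⟩
      rw [card_erase_of_mem hxC, hC] at h5
      have := card_sdiff_add_card_inter A C
      omega
    have h4' : (2 : ℝ) ≤ #(A \ C) := by exact_mod_cast h4
    rw [h3] at h1 ⊢
    linarith
  · have h3 : w x = 8 := by simp [hw, hxA, hxC]
    rw [h3]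
    calc ∑ j ∈ G.neighborFinset x, w j
        ≤ ∑ j ∈ G.neighborFinset x, ((8 : ℝ) + if j ∈ C then 4 else 0) :=
          sum_le_sum fun j _ => by simp only [hw]; split_ifs <;> norm_num
      _ = G.degree x * 8 + #(G.neighborFinset x ∩ C) * 4 := by
          rw [sum_add_distrib, sum_ite_mem]
          simp
      _ ≤ 3 * 8 + 2 * 4 := by
          have h4 : (G.degree x : ℝ) ≤ 3 := by exact_mod_cast hdC x hxC
          have h5 : (#(G.neighborFinset x ∩ C) : ℝ) ≤ 2 := by
            exact_mod_cast hC ▸ card_le_card inter_subset_right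
          linarith
      _ = 4 * 8 := by norm_num

/-- The number of edges determines the graph with a dominating vertex `c`, two pendant vertices and
a clique on the remaining vertices. -/
lemma adj_iff_of_obstruction [DecidableEq V] {G : SimpleGraph V} [DecidableRel G.Adj]
    (hn : 7 ≤ Fintype.card V) {A : Finset V} {c : V}
    (hA : 2 ≤ #A) (hdA : ∀ x ∈ A, G.degree x ≤ 1)
    (hdC : ∀ x, x ∉ ({c} : Finset V) → G.degree x + 1 + 2 ≤ Fintype.card V)
    (hsum : (Fintype.card V : ℤ) ^ 2 - 5 * Fintype.card V + 10 ≤ ∑ x, (G.degree x : ℤ)) :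
    #A = 2 ∧ c ∉ A ∧ ∀ x y, G.Adj x y ↔ x ≠ y ∧ (x = c ∨ y = c ∨ (x ∉ A ∧ y ∉ A)) := by
  have hle := degree_le_of_obstruction (G := G) hdA hdC
  have htot := sum_obstruction (V := V) 1 A {c}
  rw [card_singleton] at htot
  have hsum' := sum_le_sum fun x (_ : x ∈ univ) => hle x
  rw [htot] at hsum'
  have hn' : (7 : ℤ) ≤ Fintype.card V := by exact_mod_cast hn
  -- Each vertex of `A` beyond the second lowers the upper bound by `n - 4 > 0`, while two already
  -- make it equal to the lower bound.
  have hA2 : #A = 2 := by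
    by_contra hne
    have : (3 : ℤ) ≤ #A := by omega
    push_cast at *
    nlinarith
  -- Equality of the sums forces equality at each vertex: degree `n - 1` at `c`, `1` on `A`, `n - 3`
  -- elsewhere.
  have heq := (sum_eq_sum_iff_of_le fun x (_ : x ∈ univ) => hle x).mp (by
    refine le_antisymm (htot.symm ▸ hsum') (le_trans (le_of_eq ?_) hsum)
    rw [htot, hA2]
    push_cast
    ring)
  have hdeg := fun x => heq x (mem_univ x)
  clear heq hle htot hsum' hsum
  have hcA : c ∉ A := fun hc => by
    have h1 := hdeg c
    have h2 := hdA c hc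
    simp only [hc, mem_singleton, if_true] at h1
    push_cast at h1
    omega
  have hc : ∀ y, y ≠ c → G.Adj c y := fun y hy => by
    have h1 := hdeg c
    simp only [hcA, mem_singleton, if_true, if_false] at h1
    have h2 : G.neighborFinset c = univ.erase c := by
      refine eq_of_subset_of_card_le (fun z hz => ?_) ?_
      · simpa using ((mem_neighborFinset _ _ _).mp hz).ne'
      · rw [card_erase_of_mem (mem_univ c), card_neighborFinset_eq_degree, card_univ]
        push_cast at h1
        omega
    rw [← mem_neighborFinset, h2]
    simp [hy]
  have hpend : ∀ x ∈ A, ∀ y, G.Adj x y → y = c := fun x hx y hxy => by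
    have hxc : G.Adj x c := (hc x fun h => hcA (h ▸ hx)).symm
    have h1 := hdA x hx
    rw [← card_neighborFinset_eq_degree] at h1
    exact card_le_one.mp h1 y (by simpa using hxy) c (by simpa using hxc)
  refine ⟨hA2, hcA, fun x y => ⟨fun hxy => ⟨hxy.ne, ?_⟩, ?_⟩⟩
  · by_contra! hcon
    obtain ⟨h1, h2, h3⟩ := hcon
    by_cases hx : x ∈ A
    · exact h2 (hpend x hx y hxy)
    · exact h1 (hpend y (h3 hx) x hxy.symm)
  · rintro ⟨hne, rfl | rfl | ⟨hx, hy⟩⟩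
    · exact hc y hne.symm
    · exact (hc x hne).symm
    · by_cases hxc : x = c
      · exact hxc ▸ hc y fun h => hne (hxc.trans h.symm)
      have h1 := hdeg x
      simp only [hx, mem_singleton, hxc, if_false] at h1
      have h2 : G.neighborFinset x = univ \ insert x A := by
        refine eq_of_subset_of_card_le (fun z hz => ?_) ?_
        · rw [mem_neighborFinset] at hz
          simp only [mem_sdiff, mem_univ, mem_insert, true_and, not_or]
          exact ⟨hz.ne', fun hzA => hxc (hpend z hzA x hz.symm)⟩
        · rw [card_sdiff_of_subset (subset_univ _), card_insert_of_notMem hx,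
            card_neighborFinset_eq_degree, card_univ, hA2]
          push_cast at h1
          omega
      rw [← mem_neighborFinset, h2]
      simp [hy, hne.symm]

end Degrees

/-! ### The extremal graph: isomorphism type, nontraceability, spectral radius -/

section Extremal

/-- Two graphs made of a dominating vertex, two pendant vertices and a clique on the remaining
vertices are isomorphic if they have the same number of vertices. -/
lemma nonempty_iso_of_adj_iff {V W : Type*} [Fintype V] [Fintype W] [DecidableEq V]
    [DecidableEq W] {G : SimpleGraph V} {H : SimpleGraph W}
    (hcard : Fintype.card V = Fintype.card W) {c : V} {A : Finset V} {d : W} {B : Finset W}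
    (hAB : #A = #B) (hc : c ∉ A) (hd : d ∉ B)
    (hG : ∀ x y, G.Adj x y ↔ x ≠ y ∧ (x = c ∨ y = c ∨ (x ∉ A ∧ y ∉ A)))
    (hH : ∀ x y, H.Adj x y ↔ x ≠ y ∧ (x = d ∨ y = d ∨ (x ∉ B ∧ y ∉ B))) :
    Nonempty (G ≃g H) := by
  -- Adjacency of distinct vertices depends only on these colours, so any colour-preserving
  -- bijection is an isomorphism; it exists once the colour classes have equal sizes.
  set f : V → Bool × Bool := fun x => (decide (x = c), decide (x ∈ A)) with hf
  set g : W → Bool × Bool := fun x => (decide (x = d), decide (x ∈ B)) with hg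
  have hfib : ∀ b, #{x | f x = b} = #{x | g x = b} := by
    rintro ⟨b₁, b₂⟩
    have e₁ : #({x | x ≠ c ∧ x ∉ A} : Finset V) = Fintype.card V - (#A + 1) := by
      rw [← card_insert_of_notMem hc, ← card_univ, ← card_sdiff_of_subset (subset_univ _)]
      congr 1
      ext x
      simp
    have e₂ : #({x | x ≠ d ∧ x ∉ B} : Finset W) = Fintype.card W - (#B + 1) := by
      rw [← card_insert_of_notMem hd, ← card_univ, ← card_sdiff_of_subset (subset_univ _)]
      congr 1
      ext x
      simp
    have e₃ : ({x | x = c ∧ x ∈ A} : Finset V) = ∅ := by ext x; simp; rintro rfl; exact hc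
    have e₄ : ({x | x = d ∧ x ∈ B} : Finset W) = ∅ := by ext x; simp; rintro rfl; exact hd
    have e₅ : ({x | x = c ∧ x ∉ A} : Finset V) = {c} := by ext x; simp; rintro rfl; exact hc
    have e₆ : ({x | x = d ∧ x ∉ B} : Finset W) = {d} := by ext x; simp; rintro rfl; exact hd
    have e₇ : ({x | x ≠ c ∧ x ∈ A} : Finset V) = A := by
      ext x; simp; rintro hx rfl; exact hc hx
    have e₈ : ({x | x ≠ d ∧ x ∈ B} : Finset W) = B := by
      ext x; simp; rintro hx rfl; exact hd hx
    cases b₁ <;> cases b₂ <;> simp only [hf, hg, Prod.mk.injEq, decide_eq_true_eq,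
      decide_eq_false_iff_not]
    · exact e₁.trans (hcard ▸ hAB ▸ e₂.symm)
    · exact (congrArg card e₇).trans (hAB.trans (congrArg card e₈).symm)
    · rw [e₅, e₆, card_singleton, card_singleton]
    · rw [e₃, e₄, card_empty, card_empty]
  have hequiv : ∀ b, Nonempty ({x // f x = b} ≃ {x // g x = b}) := fun b =>
    ⟨Fintype.equivOfCardEq (by rw [Fintype.card_subtype, Fintype.card_subtype, hfib b])⟩
  let e := fun b => (hequiv b).some
  set E : V ≃ W := Equiv.ofFiberEquiv e with hE
  have hcol : ∀ x, g (E x) = f x := Equiv.ofFiberEquiv_map e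
  simp only [hf, hg, Prod.mk.injEq, decide_eq_decide] at hcol
  refine ⟨⟨E, fun {x y} => ?_⟩⟩
  rw [hG, hH, (hcol x).1, (hcol y).1, (hcol x).2, (hcol y).2, E.injective.ne_iff]

lemma extremalGraph_adj_iff (n : ℕ) (x y : Fin 1 ⊕ (Fin (n - 3) ⊕ (Fin 1 ⊕ Fin 1))) :
    (extremalGraph n).Adj x y ↔ x ≠ y ∧ (x = Sum.inl 0 ∨ y = Sum.inl 0 ∨
      (x ∉ ({Sum.inr (Sum.inr (Sum.inl 0)), Sum.inr (Sum.inr (Sum.inr 0))} :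
        Finset (Fin 1 ⊕ (Fin (n - 3) ⊕ (Fin 1 ⊕ Fin 1)))) ∧
      y ∉ ({Sum.inr (Sum.inr (Sum.inl 0)), Sum.inr (Sum.inr (Sum.inr 0))} :
        Finset (Fin 1 ⊕ (Fin (n - 3) ⊕ (Fin 1 ⊕ Fin 1)))))) := by
  rcases x with x | x | x | x <;> rcases y with y | y | y | y <;>
    simp [extremalGraph, graphJoin, completeGraph, Fin.fin_one_eq_zero]

/-- A graph on at least four vertices with two vertices whose only neighbour is `c` has no Hamilton
path. -/
lemma not_hasHamiltonPath_of_pendant {V : Type*} [Fintype V] [DecidableEq V] {G : SimpleGraph V}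
    (hn : 4 ≤ Fintype.card V) {c z₁ z₂ : V} (hne : z₁ ≠ z₂) (h₁ : ∀ y, G.Adj z₁ y → y = c)
    (h₂ : ∀ y, G.Adj z₂ y → y = c) : ¬ G.HasHamiltonPath := by
  have : Nonempty V := ⟨c⟩
  rw [hasHamiltonPath_iff_exists_list]
  rintro ⟨l, hnd, hmem, hc⟩
  have hlen : l.length = Fintype.card V := by
    rw [← List.toFinset_card_of_nodup hnd, ← card_univ]
    congr 1
    ext x
    simpa using hmem x
  rw [List.isChain_iff_getElem] at hc
  have hnext : ∀ z, (∀ y, G.Adj z y → y = c) → ∀ i, (hi : i + 1 < l.length) → l[i] = z →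
      l[i + 1] = c := fun z hz i hi h => hz _ (h ▸ hc i hi)
  have hprev : ∀ z, (∀ y, G.Adj z y → y = c) → ∀ i, (hi : i + 1 < l.length) → l[i + 1] = z →
      l[i] = c := fun z hz i hi h => hz _ (h ▸ (hc i hi).symm)
  have hinj : ∀ i j, (hi : i < l.length) → (hj : j < l.length) → l[i] = c → l[j] = c → i = j :=
    fun i j hi hj h h' => hnd.getElem_inj_iff.mp (h.trans h'.symm)
  -- An interior pendant vertex would have `c` on both sides of it.
  have hend : ∀ z, (∀ y, G.Adj z y → y = c) → ∀ i, (hi : i < l.length) → l[i] = z →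
      i = 0 ∨ i + 1 = l.length := by
    intro z hz i hi h
    by_contra! hcon
    obtain ⟨k, rfl⟩ := Nat.exists_eq_add_one_of_ne_zero hcon.1
    have h3 := hinj k (k + 1 + 1) (by omega) (by omega) (hprev z hz k hi h)
      (hnext z hz (k + 1) (by omega) h)
    omega
  -- With pendants at both ends, `c` is second and second to last, which forces length `3`.
  have hfar : ∀ z w, (∀ y, G.Adj z y → y = c) → (∀ y, G.Adj w y → y = c) → ∀ i j,
      (hi : i < l.length) → (hj : j < l.length) → l[i] = z → l[j] = w → i = 0 →
      j + 1 = l.length → False := by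
    rintro z w hz hw i j hi hj h h' rfl hj'
    obtain ⟨k, rfl⟩ := Nat.exists_eq_add_one_of_ne_zero (show j ≠ 0 by omega)
    have h3 := hinj (0 + 1) k (by omega) (by omega) (hnext z hz 0 (by omega) h)
      (hprev w hw k hj h')
    omega
  obtain ⟨i, hi, hiz⟩ := List.getElem_of_mem (hmem z₁)
  obtain ⟨j, hj, hjz⟩ := List.getElem_of_mem (hmem z₂)
  have hij : i ≠ j := by
    rintro rfl
    exact hne (hiz.symm.trans hjz)
  rcases hend z₁ h₁ i hi hiz with h | h <;> rcases hend z₂ h₂ j hj hjz with h' | h'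
  · omega
  · exact hfar z₁ z₂ h₁ h₂ i j hi hj hiz hjz h h'
  · exact hfar z₂ z₁ h₂ h₁ j i hj hi hjz hiz h' h
  · omega

/-- The largest root of the quotient polynomial of `extremalGraph n` exceeds `n - 3`. -/
lemma lt_spectralRadius_extremalGraph {n : ℕ} (hn : 7 ≤ n) :
    (n : ℝ) - 3 < (extremalGraph n).spectralRadius := by
  classical
  have hn' : (7 : ℝ) ≤ n := by exact_mod_cast hn
  -- This is the eigenvalue equation at the dominating vertex with value `1` there; the other
  -- equations force `1 / (t - (n - 4))` on the clique and `1 / t` on the pendants.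
  obtain ⟨t, ht, hroot⟩ : ∃ t ∈ Set.Icc ((n : ℝ) - 3) n,
      2 / t + (n - 3) / (t - (n - 4)) - t = 0 := by
    have hcont : ContinuousOn (fun t : ℝ => 2 / t + (n - 3) / (t - (n - 4)) - t)
        (Set.Icc ((n : ℝ) - 3) n) := by
      refine ContinuousOn.sub (ContinuousOn.add ?_ ?_) continuousOn_id
      · exact continuousOn_const.div continuousOn_id fun x hx => ne_of_gt (by linarith [hx.1])
      · exact continuousOn_const.div (continuousOn_id.sub continuousOn_const) fun x hx => ne_of_gt (by linarith [hx.1])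
    refine intermediate_value_Icc' (by linarith) hcont ⟨?_, ?_⟩
    · have h1 : 2 / (n : ℝ) ≤ 1 := by rw [div_le_one] <;> linarith
      have h2 : ((n : ℝ) - 3) / (n - (n - 4)) ≤ n - 1 := by
        rw [div_le_iff₀] <;> linarith
      linarith
    · have h1 : 0 < 2 / ((n : ℝ) - 3) := div_pos (by norm_num) (by linarith)
      have h2 : ((n : ℝ) - 3) / ((n - 3) - (n - 4)) = n - 3 := by
        rw [show ((n : ℝ) - 3) - (n - 4) = 1 by ring, div_one]
      linarith
  have htpos : 0 < t := by linarith [ht.1]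
  have hspos : 0 < t - (n - 4) := by linarith [ht.1]
  have hlt : (n : ℝ) - 3 < t := by
    refine lt_of_le_of_ne ht.1 fun h => ?_
    have h1 : 0 < 2 / t := div_pos (by norm_num) htpos
    rw [← h, show ((n : ℝ) - 3) - (n - 4) = 1 by ring, div_one, h] at hroot
    linarith
  refine hlt.trans_le (le_spectralRadius (extremalGraph n)
    (y := Sum.elim (fun _ => 1) (Sum.elim (fun _ => 1 / (t - (n - 4)))
      (fun _ => 1 / t))) (fun h => ?_) fun i => ?_)
  · simpa using congrFun h (Sum.inl 0)
  have hcast : ((n - 3 : ℕ) : ℝ) = n - 3 := by push_cast [show 3 ≤ n by omega]; ring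
  rw [neighborFinset_eq_filter, sum_filter, Fintype.sum_sum_type, Fintype.sum_sum_type]
  rcases i with i | i | i | i
  · simp [extremalGraph, graphJoin, completeGraph, Subsingleton.elim i 0, hcast]
    rw [div_eq_mul_inv, div_eq_mul_inv] at hroot
    linarith
  · simp [extremalGraph, graphJoin, completeGraph]
    have hclique : ∀ x, (if i = x then 0 else (t - (n - 4))⁻¹) =
        (t - (n - 4))⁻¹ - if i = x then (t - (n - 4))⁻¹ else 0 := fun x => by split_ifs <;> simp
    simp only [hclique]
    rw [sum_sub_distrib, sum_ite_eq univ i]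
    simp [hcast]
    field_simp
    ring
  · simp [extremalGraph, graphJoin, completeGraph, Subsingleton.elim i 0, htpos.ne']
  · simp [extremalGraph, graphJoin, completeGraph, Subsingleton.elim i 0, htpos.ne']

lemma card_extremalGraph {n : ℕ} (hn : 3 ≤ n) :
    Fintype.card (Fin 1 ⊕ (Fin (n - 3) ⊕ (Fin 1 ⊕ Fin 1))) = n := by
  simp only [Fintype.card_sum, Fintype.card_fin]
  omega

lemma not_hasHamiltonPath_extremalGraph {n : ℕ} (hn : 4 ≤ n) :
    ¬ (extremalGraph n).HasHamiltonPath := by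
  refine not_hasHamiltonPath_of_pendant (by rw [card_extremalGraph (by omega)]; exact hn)
    (c := Sum.inl 0) (z₁ := Sum.inr (Sum.inr (Sum.inl 0))) (z₂ := Sum.inr (Sum.inr (Sum.inr 0)))
    (by simp) ?_ ?_ <;>
  · intro y hy
    rw [extremalGraph_adj_iff] at hy
    simpa using hy.2

lemma HasHamiltonPath.map_iso {V W : Type*} [DecidableEq V] [DecidableEq W] {G : SimpleGraph V}
    {H : SimpleGraph W} (e : G ≃g H) (h : G.HasHamiltonPath) : H.HasHamiltonPath := by
  obtain ⟨a, b, p, hp⟩ := h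
  exact ⟨_, _, p.map e.toHom, hp.map e.toHom e.bijective⟩

/-! ### Edge count from `ρ > n - 3`, and exclusion of `h ≥ 2` -/

/-- A graph without isolated vertices and with `ρ > n - 3` has degree sum at least
`n² - 5n + 10`. -/
lemma le_sum_degree_of_lt_spectralRadius {V : Type*} [Fintype V] [DecidableEq V]
    (G : SimpleGraph V) [DecidableRel G.Adj] (hn : 3 ≤ Fintype.card V)
    (hd : ∀ v, 1 ≤ G.degree v) (hρ : (Fintype.card V : ℝ) - 3 < G.spectralRadius) :
    (Fintype.card V : ℤ) ^ 2 - 5 * Fintype.card V + 10 ≤ ∑ x, (G.degree x : ℤ) := by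
  have hn' : (3 : ℝ) ≤ Fintype.card V := by exact_mod_cast hn
  have h1 := G.sq_spectralRadius_le hd (by linarith)
  have h2 : ((Fintype.card V : ℝ) - 3) ^ 2 < G.spectralRadius ^ 2 :=
    pow_lt_pow_left₀ hρ (by linarith) two_ne_zero
  rw [G.sum_degrees_eq_twice_card_edges] at h1
  rw [← Nat.cast_sum, G.sum_degrees_eq_twice_card_edges]
  generalize Fintype.card V = n at *
  generalize #G.edgeFinset = m at *
  have h3 : (n : ℤ) ^ 2 - 5 * n + 8 < ((2 * m : ℕ) : ℤ) := by
    have : (n : ℝ) ^ 2 - 5 * n + 8 < ((2 * m : ℕ) : ℝ) := by linarith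
    exact_mod_cast this
  push_cast at h3 ⊢
  -- Both sides are even, so the strict inequality gains `2`.
  rcases Int.even_or_odd' (n : ℤ) with ⟨k, hk | hk⟩ <;> rw [hk] at h3 ⊢ <;> ring_nf at h3 ⊢ <;>
    omega

/-- A graph with the degree pattern of a nontraceable graph and `ρ > n - 3` has the parameter
`h = 1`. -/
lemma eq_one_of_obstruction {V : Type*} [Fintype V] [DecidableEq V] {G : SimpleGraph V}
    [DecidableRel G.Adj] (hn : 7 ≤ Fintype.card V)
    (hρ : (Fintype.card V : ℝ) - 3 < G.spectralRadius)
    (hsum : (Fintype.card V : ℤ) ^ 2 - 5 * Fintype.card V + 10 ≤ ∑ x, (G.degree x : ℤ))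
    {h : ℕ} {A C : Finset V} (h1 : 1 ≤ h) (hh : 2 * h + 2 ≤ Fintype.card V) (hA : h + 1 ≤ #A)
    (hC : #C = h) (hdA : ∀ x ∈ A, G.degree x ≤ h)
    (hdC : ∀ x, x ∉ C → G.degree x + h + 2 ≤ Fintype.card V) : h = 1 := by
  by_contra hne
  have h2 : (2 : ℤ) ≤ h := by omega
  have hle := sum_le_sum fun x (_ : x ∈ univ) => degree_le_of_obstruction hdA hdC x
  rw [sum_obstruction, hC] at hle
  have h3 : ((h : ℤ) + 1) * (Fintype.card V - 2 - 2 * h) ≤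
      #A * ((Fintype.card V : ℤ) - 2 - 2 * h) :=
    mul_le_mul_of_nonneg_right (by exact_mod_cast hA) (by omega)
  have h4 : 0 ≤ ((h : ℤ) - 1) * (3 * h + 8 - 2 * Fintype.card V) := by linarith
  have h5 : 0 ≤ 3 * (h : ℤ) + 8 - 2 * Fintype.card V :=
    nonneg_of_mul_nonneg_right h4 (by omega)
  have h6 : h ≤ 4 := by omega
  have h7 : 2 ≤ h := by omega
  clear h3 h4 hle hsum
  -- Together, `h5`, `hh` and `7 ≤ n` leave one value of `n` for each `h`; the radii `4`, `5`, `7`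
  -- used below are `n - 3`.
  interval_cases h
  · have hV : Fintype.card V = 7 := by omega
    have := G.spectralRadius_le_four hV hA hC hdA fun x hx => by have := hdC x hx; omega
    rw [hV] at hρ
    norm_num at hρ
    linarith
  · have hV : Fintype.card V = 8 := by omega
    have := G.spectralRadius_le_of_degree_le (r := 5) (by norm_num) (by norm_num) hC
      (fun x hx => by have := hdC x hx; omega) (by rw [hV]; norm_num)
    rw [hV] at hρ
    norm_num at hρ
    linarith
  · have hV : Fintype.card V = 10 := by omega
    have := G.spectralRadius_le_of_degree_le (r := 7) (by norm_num) (by norm_num) hC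
      (fun x hx => by have := hdC x hx; omega) (by rw [hV]; norm_num)
    rw [hV] at hρ
    norm_num at hρ
    linarith

end Extremal

end SimpleGraph

theorem corollary3 {V : Type*} [Fintype V] [DecidableEq V] (G : SimpleGraph V)
    [DecidableRel G.Adj] (n : ℕ) (hV : Fintype.card V = n) (hn : 7 ≤ n)
    (hδ : 1 ≤ G.minDegree)
    (hρ : (SimpleGraph.extremalGraph n).spectralRadius ≤ G.spectralRadius) :
    ¬ G.HasHamiltonPath ↔ Nonempty (G ≃g SimpleGraph.extremalGraph n) := by
  subst hV
  constructor
  · intro hG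
    have : Nonempty V := Fintype.card_pos_iff.mp (by omega)
    have hd : ∀ v, 1 ≤ G.degree v := fun v => hδ.trans (G.minDegree_le_degree v)
    have hlt := (SimpleGraph.lt_spectralRadius_extremalGraph hn).trans_le hρ
    have hsum := G.le_sum_degree_of_lt_spectralRadius (by omega) hd hlt
    obtain ⟨h, A, C, h1, hh, hA, hC, hdA, hdC⟩ := SimpleGraph.exists_degree_obstruction hG hd
    obtain rfl := SimpleGraph.eq_one_of_obstruction hn hlt hsum h1 hh hA hC hdA hdC
    obtain ⟨c, rfl⟩ := Finset.card_eq_one.mp hC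
    obtain ⟨hA2, hcA, hadj⟩ := SimpleGraph.adj_iff_of_obstruction hn hA hdA hdC hsum
    exact SimpleGraph.nonempty_iso_of_adj_iff (SimpleGraph.card_extremalGraph (by omega)).symm
      (by rw [hA2]; rfl) hcA (by simp) hadj (SimpleGraph.extremalGraph_adj_iff _)
  · rintro ⟨e⟩ hG
    exact SimpleGraph.not_hasHamiltonPath_extremalGraph (by omega) (hG.map_iso e)
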